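/- Let $G$ be a group and let $Q$ be a quasi-normal subgroup of $G$, i.e. for every $g\in G$ the subgroup $gQg^{-1}\cap Q$ has finite index in both $Q$ and $gQg^{-1}$. For a finite generating set $S$ of $G$ let $\Lambda(S,Q,G)$ be the graph whose vertices are the left cosets $gQ$, with an edge labeled $s$ from $gQ$ to $fQ$ whenever $s\in S$ and $gq_1sq_2=f$ for some $q_1,q_2\in Q$ (edge paths may traverse edges in either direction). An end of a graph is an equivalence class of proper infinite edge paths, that is, infinite edge paths that visit each vertex only finitely often; two such paths $r,r'$ are equivalent if for every finite subgraph $C$ there is an edge path in the complement of $C$ from a vertex of $r$ to a vertex of $r'$. Then for every finite generating set $S$ of $G$ the set of ends of $\Lambda(S,Q,G)$ has $0$, $1$ or $2$ elements or is uncountable. Moreover, for any two finite generating sets $S$ and $T$ of $G$, the sets of ends of $\Lambda(S,Q,G)$ and $\Lambda(T,Q,G)$ have the same cardinality. -/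

import Mathlib

/-- A subgroup `Q` of `G` is quasi-normal if its commensurator is the whole group: for every
`g : G` the intersection of `g Q g⁻¹` and `Q` has finite index in both. -/
def Subgroup.IsQuasiNormal {G : Type*} [Group G] (Q : Subgroup G) : Prop :=
  Subgroup.Commensurable.commensurator Q = ⊤

/-- `IsCosetEdge S H v s w`: there is a directed edge labelled `s` from the left coset `v` to the
left coset `w`, that is, `s ∈ S` and, writing `v = gH` and `w = fH`, we have `g h₁ s h₂ = f` for
some `h₁, h₂ ∈ H`. -/
def IsCosetEdge {G : Type*} [Group G] (S : Set G) (H : Subgroup G) (v : G ⧸ H) (s : G)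
    (w : G ⧸ H) : Prop :=
  s ∈ S ∧ ∃ g f : G, (g : G ⧸ H) = v ∧ (f : G ⧸ H) = w ∧
    ∃ h₁ ∈ H, ∃ h₂ ∈ H, g * h₁ * s * h₂ = f

/-- The left coset graph `Λ(S, H, G)`. Its vertices are the left cosets of `H`; its edges are the
triples `(v, s, w)` with `IsCosetEdge S H v s w`, such an edge joining `v` and `w`. Loops and
multiple edges (with different labels or directions) are allowed; edge paths may traverse an edge
in either direction. -/
def cosetGraph {G : Type*} [Group G] (S : Set G) (H : Subgroup G) :
    Graph (G ⧸ H) ((G ⧸ H) × G × (G ⧸ H)) where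
  vertexSet := Set.univ
  IsLink e x y := IsCosetEdge S H e.1 e.2.1 e.2.2 ∧
    ((x = e.1 ∧ y = e.2.2) ∨ (x = e.2.2 ∧ y = e.1))
  isLink_symm _ _ := ⟨fun _ _ h => ⟨h.1, h.2.symm.imp And.symm And.symm⟩⟩
  eq_or_eq_of_isLink_of_isLink := by
    rintro e x y v w ⟨-, ⟨rfl, rfl⟩ | ⟨rfl, rfl⟩⟩ ⟨-, ⟨rfl, rfl⟩ | ⟨rfl, rfl⟩⟩ <;> simp
  left_mem_of_isLink _ _ _ _ := Set.mem_univ _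

namespace Graph

variable {α β : Type*}

/-- A proper edge path `[0, ∞) → X` in a graph: an infinite sequence of consecutive edges which
visits every vertex only finitely often. (Every compact subset of a graph lies in a finite
subgraph, and an edge path traverses an edge only when it visits its end points, so this is
properness of the path as a continuous map.) -/
structure ProperRay (X : Graph α β) where
  vert : ℕ → α
  edge : ℕ → β
  isLink : ∀ n, X.IsLink (edge n) (vert n) (vert (n + 1))
  proper : ∀ v, {n | vert n = v}.Finite

/-- There is a (finite, possibly trivial) edge path from `x` to `y` none of whose vertices lies
in `C`; equivalently an edge path in the complement of any subgraph with vertex set `C`. -/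
def JoinedOutside (X : Graph α β) (C : Set α) (x y : α) : Prop :=
  x ∉ C ∧ Relation.ReflTransGen (fun a b => b ∉ C ∧ X.Adj a b) x y

/-- Two proper edge paths converge to the same end if outside any finite subgraph some vertex of
the first can be joined to some vertex of the second. -/
def ProperRay.SameEnd {X : Graph α β} (r s : X.ProperRay) : Prop :=
  ∀ C : Set α, C.Finite → ∃ i j, X.JoinedOutside C (r.vert i) (s.vert j)

theorem JoinedOutside.right_notMem {X : Graph α β} {C : Set α} {x y : α}
    (h : X.JoinedOutside C x y) : y ∉ C := by
  obtain ⟨hx, h⟩ := h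
  cases h with
  | refl => exact hx
  | tail _ h => exact h.1

theorem JoinedOutside.trans {X : Graph α β} {C : Set α} {x y z : α}
    (h : X.JoinedOutside C x y) (h' : X.JoinedOutside C y z) : X.JoinedOutside C x z :=
  ⟨h.1, h.2.trans h'.2⟩

theorem JoinedOutside.symm {X : Graph α β} {C : Set α} {x y : α}
    (h : X.JoinedOutside C x y) : X.JoinedOutside C y x := by
  obtain ⟨hx, h⟩ := h
  induction h with
  | refl => exact ⟨hx, .refl⟩
  | @tail b c hb hbc ih => exact ⟨hbc.1, .head ⟨ih.1, hbc.2.symm⟩ ih.2⟩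

theorem JoinedOutside.mono {X : Graph α β} {C D : Set α} {x y : α} (hCD : C ⊆ D)
    (h : X.JoinedOutside D x y) : X.JoinedOutside C x y :=
  ⟨fun hx => h.1 (hCD hx), 
    Relation.ReflTransGen.mono (fun _ _ hab => ⟨fun hb => hab.1 (hCD hb), hab.2⟩) _ _ h.2⟩

theorem ProperRay.exists_forall_notMem {X : Graph α β} (r : X.ProperRay) {C : Set α}
    (hC : C.Finite) : ∃ N, ∀ n, N ≤ n → r.vert n ∉ C := by
  have hfin : {n | r.vert n ∈ C}.Finite := by
    refine (hC.biUnion fun v _ => r.proper v).subset fun n hn => ?_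
    simpa using hn
  obtain ⟨N, hN⟩ := hfin.bddAbove
  exact ⟨N + 1, fun n hn h => absurd (hN h) (by omega)⟩

theorem ProperRay.joinedOutside {X : Graph α β} (r : X.ProperRay) {C : Set α} {N : ℕ}
    (hN : ∀ n, N ≤ n → r.vert n ∉ C) {i j : ℕ} (hi : N ≤ i) (hij : i ≤ j) :
    X.JoinedOutside C (r.vert i) (r.vert j) := by
  induction j, hij using Nat.le_induction with
  | base => exact ⟨hN i hi, .refl⟩
  | succ j hij ih => exact ⟨ih.1, ih.2.tail ⟨hN _ (by omega), _, r.isLink j⟩⟩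

theorem ProperRay.SameEnd.trans {X : Graph α β} {r s t : X.ProperRay}
    (hrs : r.SameEnd s) (hst : s.SameEnd t) : r.SameEnd t := by
  intro C hC
  obtain ⟨N, hN⟩ := s.exists_forall_notMem hC
  have hD : (C ∪ s.vert '' Set.Iio N).Finite := hC.union ((Set.finite_Iio N).image _)
  have key : ∀ n, s.vert n ∉ C ∪ s.vert '' Set.Iio N → N ≤ n := fun n hn => by
    by_contra hlt
    exact hn (Or.inr ⟨n, by simpa using hlt, rfl⟩)
  obtain ⟨i, j, hij⟩ := hrs _ hD
  obtain ⟨k, l, hkl⟩ := hst _ hD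
  have hj := key j hij.right_notMem
  have hk := key k hkl.1
  have hjk : X.JoinedOutside C (s.vert j) (s.vert k) := by
    rcases le_total j k with h | h
    · exact s.joinedOutside hN hj h
    · exact (s.joinedOutside hN hk h).symm
  exact ⟨i, l, ((hij.mono Set.subset_union_left).trans hjk).trans
    (hkl.mono Set.subset_union_left)⟩

/-- Convergence to the same end, as an equivalence relation on the proper edge paths. -/
def properRaySetoid (X : Graph α β) : Setoid X.ProperRay where
  r := ProperRay.SameEnd
  iseqv :=
    { refl := fun r C hC => by
        obtain ⟨N, hN⟩ := r.exists_forall_notMem hC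
        exact ⟨N, N, hN N le_rfl, .refl⟩
      symm := fun h C hC => by
        obtain ⟨i, j, hij⟩ := h C hC
        exact ⟨j, i, hij.symm⟩
      trans := ProperRay.SameEnd.trans }

/-- The set of ends of a graph: proper edge paths up to convergence to the same end. -/
def Ends (X : Graph α β) : Type _ := Quotient X.properRaySetoid

/-- The number of ends of a graph, as a cardinal. -/
noncomputable def numEnds (X : Graph α β) : Cardinal := Cardinal.mk X.Ends

end Graph

/-! Left multiplication makes $G$ act vertex-transitively on $\Lambda(S,Q,G)$. Generation by $S$
makes the graph connected, and quasi-normality makes it locally finite, because each $QsQ$ is a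
finite union of left cosets. The rest is graph theory.

Three ends force uncountably many (`aleph0_lt_numEnds`), by a Freudenthal–Hopf argument. Some ball
has three distinct infinite complementary components. A translate of it placed deep inside an
infinite component $U$ again has three: at most one meets a large ball around the base point and at
most one contains a tail of a prescribed end, so a third lies in $U$ and avoids both
(`exists_infinite_component_avoiding`). Iterating against an enumeration of the ends yields nested
components escaping to infinity, and a ray following them represents an end missing from the
enumeration.

For independence of the generating set, both graphs are compared with the one for $S \cup T$: each
added edge is replaced by a path of bounded length, which stays far away if the edge is far away
(`numEnds_eq_of_adj_le`). -/

namespace Graph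

variable {α β : Type*}

/-! ### Balls and paths avoiding a finite set -/

/-- `X.Within n x y`: the vertices `x` and `y` are joined by an edge path of length at most `n`. -/
def Within (X : Graph α β) : ℕ → α → α → Prop
  | 0, x, y => x = y
  | n + 1, x, y => ∃ z, Within X n x z ∧ (z = y ∨ X.Adj z y)

theorem Within.refl (X : Graph α β) (n : ℕ) (x : α) : X.Within n x x := by
  induction n with
  | zero => rfl
  | succ n ih => exact ⟨x, ih, .inl rfl⟩

theorem Within.mono {X : Graph α β} {m n : ℕ} (hmn : m ≤ n) {x y : α} (h : X.Within m x y) :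
    X.Within n x y := by
  induction n, hmn using Nat.le_induction with
  | base => exact h
  | succ n _ ih => exact ⟨y, ih, .inl rfl⟩

theorem Within.head {X : Graph α β} {n : ℕ} {x z y : α} (hxz : x = z ∨ X.Adj x z)
    (h : X.Within n z y) : X.Within (n + 1) x y := by
  induction n generalizing y with
  | zero => exact ⟨x, rfl, h ▸ hxz⟩
  | succ n ih =>
    obtain ⟨w, hw, hwy⟩ := h
    exact ⟨w, ih hw, hwy⟩

theorem Within.symm {X : Graph α β} {n : ℕ} {x y : α} (h : X.Within n x y) :
    X.Within n y x := by
  induction n generalizing y with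
  | zero => exact Eq.symm h
  | succ n ih =>
    obtain ⟨w, hw, hwy⟩ := h
    exact (ih hw).head (hwy.imp Eq.symm fun h => h.symm)

theorem Within.map {X : Graph α β} {φ : α → α} (hφ : ∀ a b, X.Adj a b → X.Adj (φ a) (φ b))
    {n : ℕ} {x y : α} (h : X.Within n x y) : X.Within n (φ x) (φ y) := by
  induction n generalizing y with
  | zero => exact congrArg φ h
  | succ n ih =>
    obtain ⟨w, hw, hwy⟩ := h
    exact ⟨φ w, ih hw, hwy.imp (congrArg φ) (hφ _ _)⟩

theorem exists_within {X : Graph α β} (hconn : ∀ a b, Relation.ReflTransGen X.Adj a b) (x y : α) :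
    ∃ n, X.Within n x y := by
  induction hconn x y with
  | refl => exact ⟨0, rfl⟩
  | tail _ h ih =>
    obtain ⟨n, hn⟩ := ih
    exact ⟨n + 1, _, hn, .inr h⟩

theorem finite_setOf_within {X : Graph α β} (hlf : ∀ a, {b | X.Adj a b}.Finite) (n : ℕ) (x : α) :
    {y | X.Within n x y}.Finite := by
  induction n with
  | zero => exact (Set.finite_singleton x).subset fun y hy => Eq.symm hy
  | succ n ih =>
    refine (ih.union (ih.biUnion fun z _ => hlf z)).subset ?_
    rintro y ⟨z, hz, rfl | hzy⟩
    · exact .inl hz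
    · exact .inr (Set.mem_biUnion hz hzy)

theorem exists_subset_setOf_within {X : Graph α β}
    (hconn : ∀ a b, Relation.ReflTransGen X.Adj a b) (o : α) {C : Set α} (hC : C.Finite) :
    ∃ n, C ⊆ {y | X.Within n o y} := by
  choose f hf using exists_within hconn o
  obtain ⟨N, hN⟩ := (hC.image f).bddAbove
  exact ⟨N, fun y hy => (hf y).mono (hN ⟨y, hy, rfl⟩)⟩

theorem Within.joinedOutside {X : Graph α β} {C : Set α} {n : ℕ} {x y : α}
    (h : X.Within n x y) (hC : ∀ z, X.Within n x z → z ∉ C) : X.JoinedOutside C x y := by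
  induction n generalizing y with
  | zero =>
    obtain rfl : x = y := h
    exact ⟨hC _ rfl, .refl⟩
  | succ n ih =>
    obtain ⟨z, hz, hzy⟩ := h
    have hxz := ih hz fun w hw => hC w (hw.mono n.le_succ)
    rcases hzy with rfl | hzy
    · exact hxz
    · exact ⟨hxz.1, hxz.2.tail ⟨hC y ⟨z, hz, .inr hzy⟩, hzy⟩⟩

/-- Every vertex of the path lies in the component of `x` outside `C`, so the path itself avoids
`D`. -/
theorem JoinedOutside.of_disjoint_component {X : Graph α β} {C D : Set α} {x y : α}
    (h : X.JoinedOutside C x y) (hD : ∀ z, X.JoinedOutside C x z → z ∉ D) :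
    X.JoinedOutside D x y := by
  obtain ⟨hx, h⟩ := h
  refine ⟨hD x ⟨hx, .refl⟩, ?_⟩
  induction h with
  | refl => exact .refl
  | tail hb hbc ih => exact ih.tail ⟨hD _ ⟨hx, hb.tail hbc⟩, hbc.2⟩

theorem JoinedOutside.map {X : Graph α β} {φ : α → α} (hφ : ∀ a b, X.Adj a b → X.Adj (φ a) (φ b))
    (hinj : φ.Injective) {C : Set α} {x y : α} (h : X.JoinedOutside C x y) :
    X.JoinedOutside (φ '' C) (φ x) (φ y) := by
  refine ⟨fun hx => h.1 (hinj.mem_set_image.1 hx), h.2.lift φ fun a b hab => ?_⟩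
  exact ⟨fun hb => hab.1 (hinj.mem_set_image.1 hb), hφ _ _ hab.2⟩

theorem joinedOutside_image_iff {X : Graph α β} {φ : α ≃ α}
    (hφ : ∀ a b, X.Adj (φ a) (φ b) ↔ X.Adj a b) {C : Set α} {x y : α} :
    X.JoinedOutside (φ '' C) (φ x) (φ y) ↔ X.JoinedOutside C x y := by
  refine ⟨fun h => ?_, .map (fun a b => (hφ a b).2) φ.injective⟩
  have := h.map (φ := φ.symm) (fun a b hab => (hφ _ _).1 (by simpa using hab)) φ.symm.injective
  simpa [Set.image_image] using this

/-- A path starting outside `C` and ending in `C` enters `C` from the component of its origin. -/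
theorem exists_joinedOutside_adj {X : Graph α β} {C : Set α} {x y : α}
    (h : Relation.ReflTransGen X.Adj x y) (hx : x ∉ C) (hy : y ∈ C) :
    ∃ a, X.JoinedOutside C x a ∧ ∃ b ∈ C, X.Adj a b := by
  suffices ∀ y, Relation.ReflTransGen X.Adj x y →
      X.JoinedOutside C x y ∨ ∃ a, X.JoinedOutside C x a ∧ ∃ b ∈ C, X.Adj a b from
    (this y h).resolve_left fun h => h.right_notMem hy
  intro y h
  induction h with
  | refl => exact .inl ⟨hx, .refl⟩
  | @tail b c _ hbc ih =>
    rcases ih with ih | ih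
    · by_cases hc : c ∈ C
      · exact .inr ⟨b, ih, c, hc, hbc⟩
      · exact .inl ⟨hx, ih.2.tail ⟨hc, hbc⟩⟩
    · exact .inr ih

/-! ### Construction of proper rays -/

theorem exists_seq_of_reflTransGen {r : α → α → Prop} {x y : α} (h : Relation.ReflTransGen r x y) :
    ∃ (n : ℕ) (p : ℕ → α), p 0 = x ∧ p n = y ∧ ∀ i < n, r (p i) (p (i + 1)) := by
  induction h with
  | refl => exact ⟨0, fun _ => x, rfl, rfl, by simp⟩
  | @tail b c _ hbc ih =>
    obtain ⟨n, p, h0, hn, hp⟩ := ih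
    refine ⟨n + 1, fun i => if i ≤ n then p i else c, by simp [h0], by simp, fun i hi => ?_⟩
    rcases Nat.lt_succ_iff_lt_or_eq.1 hi with hi | rfl
    · simpa [hi.le, Nat.succ_le_of_lt hi] using hp i hi
    · simpa [hn] using hbc

/-- Concatenation of infinitely many edge paths which leave every finite set. -/
theorem exists_properRay_of_seq_ne {X : Graph α β} {D : ℕ → Set α}
    (hD : ∀ a, ∃ N, ∀ n, N ≤ n → a ∈ D n) {v : ℕ → α} (hne : ∀ n, v n ≠ v (n + 1))
    (hv : ∀ n, X.JoinedOutside (D n) (v n) (v (n + 1))) :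
    ∃ r : X.ProperRay, ∀ n, ∃ k, n ≤ k ∧ r.vert k = v n := by
  choose L p hp0 hpL hp using fun n => exists_seq_of_reflTransGen (hv n).2
  -- Distinct consecutive terms exclude paths of length zero, which have no edge to contribute.
  have hLpos : ∀ n, 0 < L n := fun n => Nat.pos_of_ne_zero fun h => hne n <| by
    rw [← hp0 n, ← hpL n, h]
  have hout : ∀ n i, i < L n → p n i ∉ D n := fun n i hi => by
    cases i with
    | zero => exact hp0 n ▸ (hv n).1
    | succ i => exact (hp n i (by omega)).1
  -- The pair `(n, i)` is position `i` on the `n`-th path; its last vertex is recorded as position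
  -- `0` of the next path.
  let step : ℕ × ℕ → ℕ × ℕ := fun q => if q.2 + 1 < L q.1 then (q.1, q.2 + 1) else (q.1 + 1, 0)
  let q : ℕ → ℕ × ℕ := fun k => step^[k] (0, 0)
  have hq : ∀ k, q (k + 1) = step (q k) := fun k => Function.iterate_succ_apply' _ _ _
  have hlt : ∀ k, (q k).2 < L (q k).1 := fun k => by
    induction k with
    | zero => exact hLpos 0
    | succ k ih =>
      rw [hq]
      by_cases h : (q k).2 + 1 < L (q k).1
      · simp [step, h]
      · simpa [step, h] using hLpos _
  have hadj : ∀ k, X.Adj (p (q k).1 (q k).2) (p (q (k + 1)).1 (q (k + 1)).2) := fun k => by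
    have h1 := (hp _ _ (hlt k)).2
    rw [hq]
    by_cases h : (q k).2 + 1 < L (q k).1
    · simpa [step, h] using h1
    · have hL : (q k).2 + 1 = L (q k).1 := by have := hlt k; omega
      rw [hL, hpL] at h1
      simpa [step, h, hp0] using h1
  have hmono : Monotone fun k => (q k).1 := monotone_nat_of_le_succ fun k => by
    rw [hq]
    by_cases h : (q k).2 + 1 < L (q k).1 <;> simp [step, h]
  have hreach : ∀ n, ∃ k, n ≤ k ∧ q k = (n, 0) := fun n => by
    induction n with
    | zero => exact ⟨0, le_rfl, rfl⟩
    | succ n ih =>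
      obtain ⟨k, hnk, hk⟩ := ih
      have hi : ∀ i < L n, q (k + i) = (n, i) := fun i hi => by
        induction i with
        | zero => exact hk
        | succ i ih =>
          rw [← add_assoc, hq, ih (by omega)]
          simp [step, hi]
      refine ⟨k + (L n - 1) + 1, by omega, ?_⟩
      rw [hq, hi _ (by have := hLpos n; omega)]
      have := hLpos n
      simp [step, Nat.sub_add_cancel this]
  choose e he using hadj
  refine ⟨⟨fun k => p (q k).1 (q k).2, e, he, fun a => ?_⟩, fun n => ?_⟩
  · obtain ⟨N, hN⟩ := hD a
    obtain ⟨K, -, hK⟩ := hreach N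
    refine (Set.finite_Iio K).subset fun k hk => ?_
    by_contra hKk
    have hle : N ≤ (q k).1 := by simpa [hK] using hmono (not_lt.1 hKk)
    exact hout _ _ (hlt k) (hk ▸ hN _ hle)
  · obtain ⟨k, hnk, hk⟩ := hreach n
    exact ⟨k, hnk, by simp [hk, hp0]⟩

/-- A subsequence is chosen whose consecutive terms are distinct and joined outside growing balls;
hence the ray is only claimed to meet the sequence at arbitrarily late indices. -/
theorem exists_properRay_of_seq {X : Graph α β} (hlf : ∀ a, {b | X.Adj a b}.Finite)
    (hconn : ∀ a b, Relation.ReflTransGen X.Adj a b) {v : ℕ → α}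
    (hv : ∀ C : Set α, C.Finite → ∃ N, ∀ n, N ≤ n → X.JoinedOutside C (v n) (v (n + 1))) :
    ∃ r : X.ProperRay, ∀ n, ∃ k m, n ≤ k ∧ n ≤ m ∧ r.vert k = v m := by
  let D : ℕ → Set α := fun n => {y | X.Within n (v 0) y}
  have hDfin : ∀ n, (D n).Finite := fun n => finite_setOf_within hlf n _
  have hDmono : ∀ a, ∃ N, ∀ n, N ≤ n → a ∈ D n := fun a => by
    obtain ⟨N, hN⟩ := exists_within hconn (v 0) a
    exact ⟨N, fun n hn => hN.mono hn⟩
  have hjoin : ∀ C : Set α, C.Finite → ∃ N, ∀ m n, N ≤ m → m ≤ n →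
      X.JoinedOutside C (v m) (v n) := fun C hC => by
    obtain ⟨N, hN⟩ := hv C hC
    refine ⟨N, fun m n hm hmn => ?_⟩
    induction n, hmn using Nat.le_induction with
    | base => exact ⟨(hN m hm).1, .refl⟩
    | succ n hmn ih => exact ih.trans (hN n (hm.trans hmn))
  choose N hN using fun n => hjoin (D n) (hDfin n)
  have hnext : ∀ (n i : ℕ), ∃ j, i < j ∧ n ≤ j ∧ N n ≤ j ∧ v i ≠ v j := fun n i => by
    obtain ⟨M, hM⟩ := hv {v i} (Set.finite_singleton _)
    -- Beyond `M` the terms avoid `{v i}`, so they differ from `v i`.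
    refine ⟨max (max n (N n)) (max (i + 1) M), by omega, by omega, by omega, fun h => ?_⟩
    exact (hM (max (max n (N n)) (max (i + 1) M)) (by omega)).1 (by simp [h])
  choose f hf1 hf2 hf3 hf4 using hnext
  let t : ℕ → ℕ := fun n => Nat.rec (f 0 0) (fun n i => f (n + 1) i) n
  have ht : ∀ n, t (n + 1) = f (n + 1) (t n) := fun n => rfl
  have htn : ∀ n, n ≤ t n ∧ N n ≤ t n := fun n => by
    cases n with
    | zero => exact ⟨hf2 _ _, hf3 _ _⟩
    | succ n => exact ⟨hf2 _ _, hf3 _ _⟩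
  obtain ⟨r, hr⟩ := exists_properRay_of_seq_ne (v := v ∘ t) hDmono (fun n => hf4 _ _)
    fun n => hN n _ _ (htn n).2 (hf1 _ _).le
  refine ⟨r, fun n => ?_⟩
  obtain ⟨k, hk, h⟩ := hr n
  exact ⟨k, t n, hk, (htn n).1, h⟩

/-! ### Comparing the ends of two graphs -/

/-- Two locally finite connected graphs on the same vertices, the first contained in the second,
have as many ends if edges of the second far away can be replaced by paths of the first
far away. -/
theorem numEnds_eq_of_adj_le {X Y : Graph α β} (hlf : ∀ a, {b | X.Adj a b}.Finite)
    (hconn : ∀ a b, Relation.ReflTransGen X.Adj a b)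
    (hle : ∀ e a b, X.IsLink e a b → Y.IsLink e a b)
    (hfar : ∀ C : Set α, C.Finite → ∃ D : Set α, D.Finite ∧
      ∀ a b, a ∉ D → b ∉ D → Y.Adj a b → X.JoinedOutside C a b) :
    X.numEnds = Y.numEnds := by
  let F : X.ProperRay → Y.ProperRay :=
    fun r => ⟨r.vert, r.edge, fun n => hle _ _ _ (r.isLink n), r.proper⟩
  have hF : ∀ r s : X.ProperRay, r.SameEnd s → (F r).SameEnd (F s) := fun r s h C hC => by
    obtain ⟨i, j, hij⟩ := h C hC
    exact ⟨i, j, hij.1, Relation.ReflTransGen.mono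
      (fun _ _ hab => ⟨hab.1, hab.2.choose, hle _ _ _ hab.2.choose_spec⟩) _ _ hij.2⟩
  let Φ : X.Ends → Y.Ends := Quotient.map F hF
  refine Cardinal.mk_congr (Equiv.ofBijective Φ ⟨?_, ?_⟩)
  · rintro ⟨r⟩ ⟨s⟩ h
    refine Quotient.sound fun C hC => ?_
    obtain ⟨D, hD, hfar⟩ := hfar C hC
    have hrs : (F r).SameEnd (F s) := Quotient.exact h
    obtain ⟨i, j, hij⟩ := hrs (C ∪ D) (hC.union hD)
    refine ⟨i, j, ?_⟩
    obtain ⟨hi, hij⟩ := hij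
    change Relation.ReflTransGen _ (r.vert i) (s.vert j) at hij
    generalize s.vert j = y at hij
    have : y ∉ C ∪ D ∧ X.JoinedOutside C (r.vert i) y := by
      induction hij with
      | refl => exact ⟨hi, fun h => hi (.inl h), .refl⟩
      | tail _ hbc ih =>
        exact ⟨hbc.1, ih.2.trans (hfar _ _ (fun h => ih.1 (.inr h)) (fun h => hbc.1 (.inr h))
          hbc.2)⟩
    exact this.2
  · rintro ⟨r⟩
    -- The vertices of a ray of `Y` guide a ray of `X`; the two share vertices outside any finite
    -- set, so they define the same end.
    obtain ⟨s, hs⟩ := exists_properRay_of_seq hlf hconn (v := r.vert) fun C hC => by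
      obtain ⟨D, hD, hfar⟩ := hfar C hC
      obtain ⟨N, hN⟩ := r.exists_forall_notMem hD
      exact ⟨N, fun n hn => hfar _ _ (hN n hn) (hN _ (by omega)) ⟨_, r.isLink n⟩⟩
    refine ⟨Quotient.mk _ s, Quotient.sound fun C hC => ?_⟩
    obtain ⟨N, hN⟩ := r.exists_forall_notMem hC
    obtain ⟨k, m, -, hm, hkm⟩ := hs N
    refine ⟨k, m, ?_, ?_⟩
    · change s.vert k ∉ C
      exact hkm ▸ hN m hm
    · change Relation.ReflTransGen _ (s.vert k) _
      rw [hkm]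

/-! ### From three ends to uncountably many -/

theorem ProperRay.infinite_image_Ici {X : Graph α β} (r : X.ProperRay) (N : ℕ) :
    (r.vert '' Set.Ici N).Infinite := fun h => by
  obtain ⟨M, hM⟩ := r.exists_forall_notMem h
  exact hM (max N M) (le_max_right _ _) ⟨_, le_max_left N M, rfl⟩

theorem exists_not_and_not_of_fin_three {P R : Fin 3 → Prop} (hP : ∀ i j, P i → P j → i = j)
    (hR : ∀ i j, R i → R j → i = j) : ∃ i, ¬P i ∧ ¬R i := by
  by_contra! h
  have h01 : (0 : Fin 3) ≠ 1 := by decide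
  have h02 : (0 : Fin 3) ≠ 2 := by decide
  have h12 : (1 : Fin 3) ≠ 2 := by decide
  have := h 0
  have := h 1
  have := h 2
  have := hP 0 1
  have := hP 0 2
  have := hP 1 2
  have := hR 0 1
  have := hR 0 2
  have := hR 1 2
  tauto

/-- In a locally finite connected vertex-transitive graph in which the complement of some ball
has three infinite components, any infinite component of the complement of a finite set contains
another one which avoids a given finite set and a given end. -/
theorem exists_infinite_component_avoiding {X : Graph α β} (hlf : ∀ a, {b | X.Adj a b}.Finite)
    (hconn : ∀ a b, Relation.ReflTransGen X.Adj a b)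
    (htrans : ∀ a b, ∃ φ : α ≃ α, φ a = b ∧ ∀ x y, X.Adj (φ x) (φ y) ↔ X.Adj x y)
    {o : α} {k : ℕ} {x : Fin 3 → α}
    (hx : ∀ i, {y | X.JoinedOutside {z | X.Within k o z} (x i) y}.Infinite)
    (hxx : ∀ i j, X.JoinedOutside {z | X.Within k o z} (x i) (x j) → i = j)
    {C : Set α} (hC : C.Finite) {u : α} (hu : {y | X.JoinedOutside C u y}.Infinite)
    {D : Set α} (hD : D.Finite) (e : X.ProperRay) :
    ∃ (C' : Set α) (u' : α), C'.Finite ∧ {y | X.JoinedOutside C' u' y}.Infinite ∧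
      (∀ y, X.JoinedOutside C' u' y → X.JoinedOutside C u y) ∧
      (∀ y, X.JoinedOutside C' u' y → y ∉ D) ∧
      ∃ N, ∀ n, N ≤ n → ¬X.JoinedOutside C' u' (e.vert n) := by
  obtain ⟨m, hm⟩ := exists_subset_setOf_within hconn o (hC.union hD)
  set E : Set α := {y | X.Within m o y}
  set K : Set α := {z | X.Within k o z}
  have hEfin : E.Finite := finite_setOf_within hlf m o
  have hKfin : K.Finite := finite_setOf_within hlf k o
  -- Avoiding the complement of a ball means staying in the ball: balls are connected.
  have hEconn : ∀ y ∈ E, X.JoinedOutside Eᶜ o y := fun y hy =>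
    Within.joinedOutside hy fun z hz => not_not.2 hz
  have hKconn : ∀ y ∈ K, X.JoinedOutside Kᶜ o y := fun y hy =>
    Within.joinedOutside hy fun z hz => not_not.2 hz
  -- A centre in the component of `u` at distance more than `k` from `E`, so that the translated
  -- ball misses `E`.
  obtain ⟨w, hw, hwE⟩ := (hu.sdiff (hEfin.biUnion fun y _ => finite_setOf_within hlf k y)).nonempty
  obtain ⟨φ, hφo, hφ⟩ := htrans o w
  have hdisj : ∀ y ∈ K, φ y ∉ E := fun y hy hyE => by
    have : X.Within k (φ o) (φ y) := Within.map (fun a b => (hφ a b).2) hy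
    rw [hφo] at this
    exact hwE (Set.mem_biUnion hyE this.symm)
  have hEK : φ '' K ⊆ Eᶜ := by rintro _ ⟨y, hy, rfl⟩; exact hdisj y hy
  have hKC : ∀ y ∈ K, X.JoinedOutside C u (φ y) := fun y hy => by
    have h1 := (joinedOutside_image_iff hφ).2 (hKconn y hy)
    rw [hφo] at h1
    refine JoinedOutside.trans hw (h1.mono ?_)
    exact fun z hz => ⟨φ.symm z, fun hK => hdisj _ hK (by simpa using hm (.inl hz)), by simp⟩
  obtain ⟨N, hN⟩ := e.exists_forall_notMem (hKfin.image φ)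
  -- `E` and the tail of `e` are each connected off `φ '' K`, so each meets at most one of the three
  -- translated components.
  obtain ⟨i, hPi, hRi⟩ := exists_not_and_not_of_fin_three
    (P := fun i => ∃ d ∈ E, X.JoinedOutside (φ '' K) (φ (x i)) d)
    (R := fun i => ∃ n, N ≤ n ∧ X.JoinedOutside (φ '' K) (φ (x i)) (e.vert n))
    (by
      rintro i j ⟨d, hd, hid⟩ ⟨d', hd', hjd⟩
      have : X.JoinedOutside (φ '' K) d d' := ((hEconn d hd).symm.trans (hEconn d' hd')).mono hEK
      exact hxx i j ((joinedOutside_image_iff hφ).1 ((hid.trans this).trans hjd.symm)))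
    (by
      rintro i j ⟨n, hn, hin⟩ ⟨n', hn', hjn⟩
      have : X.JoinedOutside (φ '' K) (e.vert n) (e.vert n') := by
        rcases le_total n n' with h | h
        · exact e.joinedOutside hN hn h
        · exact (e.joinedOutside hN hn' h).symm
      exact hxx i j ((joinedOutside_image_iff hφ).1 ((hin.trans this).trans hjn.symm)))
  have hE : ∀ y, X.JoinedOutside (φ '' K) (φ (x i)) y → y ∉ E := fun y hy hyE => hPi ⟨y, hyE, hy⟩
  refine ⟨φ '' K, φ (x i), hKfin.image φ, ?_, fun y hy => ?_, fun y hy hyD =>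
    hE y hy (hm (.inr hyD)), N, fun n hn h => hRi ⟨n, hn, h⟩⟩
  · refine ((hx i).image φ.injective.injOn).mono ?_
    rintro _ ⟨y, hy, rfl⟩
    exact (joinedOutside_image_iff hφ).2 hy
  · have hC' : ∀ y, X.JoinedOutside (φ '' K) (φ (x i)) y → X.JoinedOutside C (φ (x i)) y :=
      fun y hy => hy.of_disjoint_component fun z hz hzC => hE z hz (hm (.inl hzC))
    -- The new component borders `φ '' K`, which lies in the component of `u`; as it avoids `C`, it
    -- lies there too.
    obtain ⟨a, ha, _, ⟨b, hb, rfl⟩, hab⟩ := exists_joinedOutside_adj (C := φ '' K)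
      (hconn (φ (x i)) (φ o)) hy.1 ⟨o, Within.refl X k o, rfl⟩
    have hab' : X.JoinedOutside C (φ b) a :=
      ⟨(hKC b hb).right_notMem, .single ⟨(hC' a ha).right_notMem, hab.symm⟩⟩
    exact ((hKC b hb).trans hab').trans ((hC' a ha).symm.trans (hC' y hy))

/-- A ball containing finite sets that separate the rays pairwise will do; the tails of the rays
make the components infinite. -/
theorem exists_three_infinite_components {X : Graph α β} (hlf : ∀ a, {b | X.Adj a b}.Finite)
    (hconn : ∀ a b, Relation.ReflTransGen X.Adj a b) (o : α) {r : Fin 3 → X.ProperRay}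
    (hr : ∀ i j, (r i).SameEnd (r j) → i = j) :
    ∃ (k : ℕ) (x : Fin 3 → α),
      (∀ i, {y | X.JoinedOutside {z | X.Within k o z} (x i) y}.Infinite) ∧
      ∀ i j, X.JoinedOutside {z | X.Within k o z} (x i) (x j) → i = j := by
  have hsep : ∀ i j, ∃ C : Set α, C.Finite ∧
      ((∃ a b, X.JoinedOutside C ((r i).vert a) ((r j).vert b)) → i = j) := fun i j => by
    by_contra! h
    exact (h ∅ Set.finite_empty).2 (hr i j fun C hC => (h C hC).1)
  choose C hCfin hC using hsep
  obtain ⟨k, hk⟩ := exists_subset_setOf_within hconn o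
    (Set.finite_iUnion fun i => Set.finite_iUnion fun j => hCfin i j)
  choose N hN using fun i => (r i).exists_forall_notMem (finite_setOf_within hlf k o)
  refine ⟨k, fun i => (r i).vert (N i), fun i => ?_, fun i j hij => ?_⟩
  · refine ((r i).infinite_image_Ici (N i)).mono ?_
    rintro _ ⟨n, hn, rfl⟩
    exact (r i).joinedOutside (hN i) le_rfl hn
  · refine hC i j ⟨_, _, hij.mono (subset_trans ?_ hk)⟩
    exact (Set.subset_iUnion (C i) j).trans (Set.subset_iUnion (fun i => ⋃ j, C i j) i)

/-- A locally finite connected vertex-transitive graph with at least three ends has uncountably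
many ends. -/
theorem aleph0_lt_numEnds {X : Graph α β} (hlf : ∀ a, {b | X.Adj a b}.Finite)
    (hconn : ∀ a b, Relation.ReflTransGen X.Adj a b)
    (htrans : ∀ a b, ∃ φ : α ≃ α, φ a = b ∧ ∀ x y, X.Adj (φ x) (φ y) ↔ X.Adj x y)
    (h3 : 3 ≤ X.numEnds) : Cardinal.aleph0 < X.numEnds := by
  by_contra hcount
  have : Countable X.Ends := Cardinal.mk_le_aleph0_iff.1 (not_lt.1 hcount)
  obtain ⟨ι⟩ : Nonempty (Fin 3 ↪ X.Ends) := Cardinal.lift_mk_le'.1 (by simpa [numEnds] using h3)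
  have : Nonempty X.Ends := ⟨ι 0⟩
  obtain ⟨f, hf⟩ := exists_surjective_nat X.Ends
  choose e he using fun n => Quotient.exists_rep (f n)
  choose ρ hρ using fun i => Quotient.exists_rep (ι i)
  set o := (ρ 0).vert 0
  obtain ⟨k, x, hx, hxx⟩ := exists_three_infinite_components hlf hconn o (r := ρ)
    fun i j h => ι.injective (by rw [← hρ i, ← hρ j]; exact Quotient.sound h)
  have hball : ∀ n, {y | X.Within n o y}.Finite := fun n => finite_setOf_within hlf n o
  choose C' u' hC'fin hinf hsub hball' havoid using
    fun (n : ℕ) (p : {p : Set α × α // p.1.Finite ∧ {y | X.JoinedOutside p.1 p.2 y}.Infinite}) =>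
      exists_infinite_component_avoiding hlf hconn htrans hx hxx p.2.1 p.2.2 (hball n) (e n)
  -- Stage `n + 1` avoids the ball of radius `n` and the `n`-th end of the enumeration.
  let s : ℕ → {p : Set α × α // p.1.Finite ∧ {y | X.JoinedOutside p.1 p.2 y}.Infinite} :=
    fun n => Nat.rec ⟨(_, x 0), hball k, hx 0⟩
      (fun n p => ⟨(C' n p, u' n p), hC'fin n p, hinf n p⟩) n
  let C : ℕ → Set α := fun n => (s n).1.1
  let v : ℕ → α := fun n => (s n).1.2
  have hvself : ∀ n, X.JoinedOutside (C n) (v n) (v n) := fun n => by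
    obtain ⟨y, hy⟩ := (s n).2.2.nonempty
    exact ⟨hy.1, .refl⟩
  have hvmem : ∀ n m, n ≤ m → ∀ y, X.JoinedOutside (C m) (v m) y →
      X.JoinedOutside (C n) (v n) y := fun n m hnm => by
    induction m, hnm using Nat.le_induction with
    | base => exact fun y hy => hy
    | succ m _ ih => exact fun y hy => ih y (hsub m (s m) y hy)
  obtain ⟨r, hr⟩ := exists_properRay_of_seq hlf hconn (v := v) fun A hA => by
    obtain ⟨m, hm⟩ := exists_subset_setOf_within hconn o hA
    refine ⟨m + 1, fun n hn => ?_⟩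
    obtain ⟨n, rfl⟩ : ∃ l, n = l + 1 := ⟨n - 1, by omega⟩
    refine (hvmem (n + 1) (n + 1 + 1) (by omega) _
      (hvself (n + 1 + 1))).of_disjoint_component
      fun z hz hzA => hball' n (s n) z hz ?_
    exact Within.mono (by omega) (hm hzA)
  obtain ⟨n, hn⟩ := hf (Quotient.mk _ r)
  obtain ⟨N, hN⟩ := havoid n (s n)
  have hCfin : (C (n + 1)).Finite := (s (n + 1)).2.1
  obtain ⟨M, hM⟩ := r.exists_forall_notMem hCfin
  have hsame : (e n).SameEnd r := Quotient.exact ((he n).trans hn)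
  -- Adding the initial segments forces the joining path to run between the two tails.
  obtain ⟨i, j, hij⟩ := hsame (C (n + 1) ∪ ((e n).vert '' Set.Iio N ∪ r.vert '' Set.Iio M))
    (hCfin.union (((Set.finite_Iio N).image _).union ((Set.finite_Iio M).image _)))
  have hi : N ≤ i := by
    by_contra h
    exact hij.1 (.inr (.inl ⟨i, not_le.1 h, rfl⟩))
  have hj : M ≤ j := by
    by_contra h
    exact hij.right_notMem (.inr (.inr ⟨j, not_le.1 h, rfl⟩))
  obtain ⟨l, m, hl, hm, hlm⟩ := hr (max M (n + 1))
  have h1 : X.JoinedOutside (C (n + 1)) (v (n + 1)) (r.vert l) :=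
    hlm ▸ hvmem (n + 1) m (by omega) _ (hvself m)
  have h2 : X.JoinedOutside (C (n + 1)) (r.vert l) (r.vert j) := by
    rcases le_total l j with h | h
    · exact r.joinedOutside hM (by omega) h
    · exact (r.joinedOutside hM hj h).symm
  exact hN i hi ((h1.trans h2).trans (hij.mono Set.subset_union_left).symm)

end Graph

/-! ### Coset graphs: transitivity, connectedness, local finiteness -/

section CosetGraph

open scoped Pointwise

variable {G : Type*} [Group G] {S : Set G} {Q : Subgroup G}

/-- The factor `h₁` is absorbed into the representative of `v`, and `h₂` into the coset `w`. -/
theorem isCosetEdge_iff {v w : G ⧸ Q} {s : G} :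
    IsCosetEdge S Q v s w ↔ s ∈ S ∧ ∃ g : G, (g : G ⧸ Q) = v ∧ ((g * s : G) : G ⧸ Q) = w := by
  constructor
  · rintro ⟨hs, g, f, rfl, rfl, h₁, hh₁, h₂, hh₂, rfl⟩
    refine ⟨hs, g * h₁, ?_, ?_⟩ <;> rw [QuotientGroup.eq] <;>
      simpa [mul_assoc] using ‹_›
  · rintro ⟨hs, g, rfl, rfl⟩
    exact ⟨hs, g, g * s, rfl, rfl, 1, Q.one_mem, 1, Q.one_mem, by simp⟩

theorem cosetGraph_adj_iff {v w : G ⧸ Q} :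
    (cosetGraph S Q).Adj v w ↔ ∃ s ∈ S, ∃ g : G,
      ((g : G ⧸ Q) = v ∧ ((g * s : G) : G ⧸ Q) = w) ∨
      ((g : G ⧸ Q) = w ∧ ((g * s : G) : G ⧸ Q) = v) := by
  constructor
  · rintro ⟨e, he, h⟩
    obtain ⟨hs, g, h1, h2⟩ := isCosetEdge_iff.1 he
    rcases h with ⟨rfl, rfl⟩ | ⟨rfl, rfl⟩
    · exact ⟨_, hs, g, .inl ⟨h1, h2⟩⟩
    · exact ⟨_, hs, g, .inr ⟨h1, h2⟩⟩
  · rintro ⟨s, hs, g, ⟨h1, h2⟩ | ⟨h1, h2⟩⟩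
    · exact ⟨(v, s, w), isCosetEdge_iff.2 ⟨hs, g, h1, h2⟩, .inl ⟨rfl, rfl⟩⟩
    · exact ⟨(w, s, v), isCosetEdge_iff.2 ⟨hs, g, h1, h2⟩, .inr ⟨rfl, rfl⟩⟩

theorem cosetGraph_adj_smul (g : G) {v w : G ⧸ Q} (h : (cosetGraph S Q).Adj v w) :
    (cosetGraph S Q).Adj (g • v) (g • w) := by
  obtain ⟨s, hs, f, h⟩ := cosetGraph_adj_iff.1 h
  refine cosetGraph_adj_iff.2 ⟨s, hs, g * f, ?_⟩
  rcases h with ⟨rfl, rfl⟩ | ⟨rfl, rfl⟩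
  · exact .inl ⟨rfl, by rw [mul_assoc]; rfl⟩
  · exact .inr ⟨rfl, by rw [mul_assoc]; rfl⟩

theorem cosetGraph_transitive (v w : G ⧸ Q) : ∃ φ : G ⧸ Q ≃ G ⧸ Q, φ v = w ∧
    ∀ x y, (cosetGraph S Q).Adj (φ x) (φ y) ↔ (cosetGraph S Q).Adj x y := by
  obtain ⟨g, hg⟩ := MulAction.exists_smul_eq G v w
  refine ⟨MulAction.toPerm g, hg, fun x y => ⟨fun h => ?_, cosetGraph_adj_smul g⟩⟩
  simpa using cosetGraph_adj_smul g⁻¹ h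

theorem cosetGraph_connected (hS : Subgroup.closure S = ⊤) (v w : G ⧸ Q) :
    Relation.ReflTransGen (cosetGraph S Q).Adj v w := by
  have key : ∀ g f : G, Relation.ReflTransGen (cosetGraph S Q).Adj (f : G ⧸ Q)
      ((f * g : G) : G ⧸ Q) := fun g => by
    have hg : g ∈ Subgroup.closure S := hS ▸ Subgroup.mem_top g
    induction hg using Subgroup.closure_induction with
    | mem s hs =>
      intro f
      exact .single (cosetGraph_adj_iff.2 ⟨s, hs, f, .inl ⟨rfl, rfl⟩⟩)
    | one =>
      intro f
      rw [mul_one]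
    | mul a b _ _ iha ihb =>
      intro f
      rw [← mul_assoc]
      exact (iha f).trans (ihb _)
    | inv a _ iha =>
      intro f
      have := iha (f * a⁻¹)
      rw [inv_mul_cancel_right] at this
      exact (Relation.ReflTransGen.mono (fun _ _ h => h.symm) _ _ this).swap
  obtain ⟨g, rfl⟩ := QuotientGroup.mk_surjective v
  obtain ⟨f, rfl⟩ := QuotientGroup.mk_surjective w
  simpa using key (g⁻¹ * f) g

/-- The double coset `Q s Q` of a quasi-normal subgroup is a finite union of left cosets. -/
theorem Subgroup.IsQuasiNormal.finite_orbit (hQ : Q.IsQuasiNormal) (s : G) :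
    (MulAction.orbit Q (s : G ⧸ Q)).Finite := by
  have hs : s ∈ Subgroup.Commensurable.commensurator Q := hQ ▸ Subgroup.mem_top s
  rw [Subgroup.Commensurable.commensurator_mem_iff] at hs
  -- The stabilizer is $Q \cap sQs^{-1}$, so its index, finite by quasi-normality, counts the orbit.
  have hstab : MulAction.stabilizer Q (s : G ⧸ Q) =
      (ConjAct.toConjAct s • Q).subgroupOf Q := by
    ext q
    rw [MulAction.mem_stabilizer_iff, Subgroup.mem_subgroupOf,
      Subgroup.mem_pointwise_smul_iff_inv_smul_mem, eq_comm]
    change ((s : G) : G ⧸ Q) = ((q * s : G) : G ⧸ Q) ↔ _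
    rw [QuotientGroup.eq, ← ConjAct.toConjAct_inv, ConjAct.toConjAct_smul]
    simp [mul_assoc]
  refine Set.finite_of_ncard_ne_zero ?_
  rw [← MulAction.index_stabilizer, hstab]
  exact hs.1

/-- The neighbours of $gQ$ lie in the translates by $g$ of $QsQ/Q$ and $Qs^{-1}Q/Q$, $s \in S$. -/
theorem cosetGraph_locallyFinite (hQ : Q.IsQuasiNormal) (hS : S.Finite) (v : G ⧸ Q) :
    {w | (cosetGraph S Q).Adj v w}.Finite := by
  obtain ⟨g, rfl⟩ := QuotientGroup.mk_surjective v
  refine (Set.Finite.image (fun w : G ⧸ Q => g • w)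
    (hS.biUnion fun s _ => (hQ.finite_orbit s).union (hQ.finite_orbit s⁻¹))).subset fun w hw => ?_
  obtain ⟨s, hs, f, ⟨h1, rfl⟩ | ⟨rfl, h1⟩⟩ := cosetGraph_adj_iff.1 hw
  · rw [eq_comm, QuotientGroup.eq] at h1
    refine ⟨g⁻¹ • ((f * s : G) : G ⧸ Q), Set.mem_biUnion hs (.inl ⟨⟨_, h1⟩, ?_⟩), by simp⟩
    change (((g⁻¹ * f) * s : G) : G ⧸ Q) = ((g⁻¹ * (f * s) : G) : G ⧸ Q)
    rw [mul_assoc]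
  · rw [eq_comm, QuotientGroup.eq] at h1
    refine ⟨g⁻¹ • (f : G ⧸ Q), Set.mem_biUnion hs (.inr ⟨⟨_, h1⟩, ?_⟩), by simp⟩
    change (((g⁻¹ * (f * s)) * s⁻¹ : G) : G ⧸ Q) = ((g⁻¹ * f : G) : G ⧸ Q)
    rw [mul_assoc, mul_inv_cancel_right]

theorem numEnds_cosetGraph_eq_of_subset (hQ : Q.IsQuasiNormal) {T : Set G} (hST : S ⊆ T)
    (hT : T.Finite) (hS : Subgroup.closure S = ⊤) :
    (cosetGraph S Q).numEnds = (cosetGraph T Q).numEnds := by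
  have hlf := cosetGraph_locallyFinite hQ (hT.subset hST)
  have hconn := cosetGraph_connected (Q := Q) hS
  refine Graph.numEnds_eq_of_adj_le hlf hconn
    (fun e a b h => ⟨⟨hST h.1.1, h.1.2⟩, h.2⟩) fun C hC => ?_
  -- `n` bounds the `S`-distance from $Q$ to all $tQ$, hence by translation between the ends of any
  -- `T`-edge.
  obtain ⟨n, hn⟩ := Graph.exists_subset_setOf_within hconn ((1 : G) : G ⧸ Q)
    (hT.image (QuotientGroup.mk (s := Q)))
  have hwithin : ∀ t ∈ T, ∀ g : G,
      (cosetGraph S Q).Within n (g : G ⧸ Q) ((g * t : G) : G ⧸ Q) := fun t ht g => by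
    have := Graph.Within.map (φ := fun v => g • v) (fun a b => cosetGraph_adj_smul g)
      (hn ⟨t, ht, rfl⟩)
    have h1 : g • ((1 : G) : G ⧸ Q) = ((g * 1 : G) : G ⧸ Q) := rfl
    simpa [h1] using this
  refine ⟨_, hC.biUnion fun c _ => Graph.finite_setOf_within hlf n c, fun a b ha hb hab => ?_⟩
  have hab' : (cosetGraph S Q).Within n a b := by
    obtain ⟨t, ht, g, ⟨rfl, rfl⟩ | ⟨rfl, rfl⟩⟩ := cosetGraph_adj_iff.1 hab
    · exact hwithin t ht g
    · exact (hwithin t ht g).symm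
  exact hab'.joinedOutside fun z hz hzC => ha (Set.mem_biUnion hzC hz.symm)

end CosetGraph

theorem theorem22 {G : Type*} [Group G] (Q : Subgroup G) (hQ : Q.IsQuasiNormal)
    (S : Set G) (hSfin : S.Finite) (hSgen : Subgroup.closure S = ⊤) :
    ((cosetGraph S Q).numEnds = 0 ∨ (cosetGraph S Q).numEnds = 1 ∨
      (cosetGraph S Q).numEnds = 2 ∨ Cardinal.aleph0 < (cosetGraph S Q).numEnds) ∧
    ∀ T : Set G, T.Finite → Subgroup.closure T = ⊤ →
      (cosetGraph T Q).numEnds = (cosetGraph S Q).numEnds := by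
  refine ⟨?_, fun T hTfin hTgen => ?_⟩
  · by_cases h3 : 3 ≤ (cosetGraph S Q).numEnds
    · exact .inr <| .inr <| .inr <| Graph.aleph0_lt_numEnds (cosetGraph_locallyFinite hQ hSfin)
        (cosetGraph_connected hSgen) cosetGraph_transitive h3
    · obtain ⟨n, hn⟩ := Cardinal.lt_aleph0.1
        ((not_le.1 h3).trans (Cardinal.natCast_lt_aleph0 (n := 3)))
      rw [hn] at h3 ⊢
      have hlt : n < 3 := by exact_mod_cast not_le.1 h3
      interval_cases n <;> simp
  · rw [numEnds_cosetGraph_eq_of_subset hQ Set.subset_union_left (hTfin.union hSfin) hTgen,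
      ← numEnds_cosetGraph_eq_of_subset hQ Set.subset_union_right (hTfin.union hSfin) hSgen]
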